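/- Let $\{X_{n,j}\}_{n,j\ge1}$ be a double array of real random variables on a probability space $(\Omega,\mathfrak F,\mathsf P)$ such that for each $n$ the variables $X_{n,1},X_{n,2},\dots$ are independent (not necessarily identically distributed), with distribution functions $F_{n,j}$, means $\mu_{n,j}$ and variances $0<\sigma_{n,j}^2<\infty$. Put $S_{n,k}=X_{n,1}+\dots+X_{n,k}$ and $B_{n,k}^2=\sigma_{n,1}^2+\dots+\sigma_{n,k}^2$ (so that $S_{n,0}=B_{n,0}^2=0$). Let $N_n$, $n\ge1$, be random variables with values in $\{0,1,2,\dots\}$ such that $N_n$ is independent of $S_{n,k}$ for all $n,k$, and such that $0<\mathsf E B_{n,N_n}^2<\infty$ for all $n$. Assume: (i) there are real numbers $\alpha_n$ with $$\mu_{n,j}=\frac{\alpha_n\sigma_{n,j}^2}{\sqrt{\mathsf E B_{n,N_n}^2}}\quad(n,j\ge1),\qquad \lim_{n\to\infty}\alpha_n=\alpha,\qquad 0<|\alpha|<\infty;$$ (ii) (the random Lindeberg condition) for every $\epsilon>0$ $$\lim_{n\to\infty}\mathsf E\,\frac{1}{B_{n,N_n}^2}\sum_{j=1}^{N_n}\int_{|x-\mu_{n,j}|>\epsilon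 B_{n,N_n}}(x-\mu_{n,j})^2\,dF_{n,j}(x)=0,$$ where the expression under the expectation is read as $0$ when $N_n=0$. Then, for every real random variable $Z$, the convergence in distribution $$\frac{S_{n,N_n}}{\sqrt{\mathsf E B_{n,N_n}^2}}\Longrightarrow Z\qquad(n\to\infty)$$ holds if and only if there is a random variable $U$ such that $$\mathsf P(Z<x)=\mathsf E\,\Phi\Big(\frac{x-\alpha U}{\sqrt U}\Big)\quad(x\in\mathbb R)\qquad\text{and}\qquad \frac{B_{n,N_n}^2}{\mathsf E B_{n,N_n}^2}\Longrightarrow U\quad(n\to\infty).$$ Here $\Phi$ is the standard normal distribution function, and on $\{U=0\}$ the value $\Phi\big((x-\alpha U)/\sqrt U\big)$ is read as $1$ if $x>0$ and as $0$ if $x\le0$. In particular, $S_{n,N_n}/\sqrt{\mathsf E B_{n,N_n}^2}$ converges in distribution to some random variable if and only if $B_{n,N_n}^2/\mathsf E B_{n,N_n}^2$ does. -/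

import Mathlib

open MeasureTheory ProbabilityTheory Filter Topology

noncomputable section

namespace RandomSums

variable {Ω : Type*} [MeasurableSpace Ω]

/-- The partial sum `S_{n,k} = X_{n,1} + ... + X_{n,k}`. Columns are numbered from `0`,
so `X n j` is the `(j + 1)`-st summand of row `n`. -/
def partialSum (X : ℕ → ℕ → Ω → ℝ) (n k : ℕ) (ω : Ω) : ℝ :=
  ∑ j ∈ Finset.range k, X n j ω

/-- `B_{n,k}^2 = σ_{n,1}^2 + ... + σ_{n,k}^2`, the sum of the variances. -/
def sumVar (P : Measure Ω) (X : ℕ → ℕ → Ω → ℝ) (n k : ℕ) : ℝ :=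
  ∑ j ∈ Finset.range k, Var[X n j; P]

/-- `E B_{n,N_n}^2`. -/
def meanSumVar (P : Measure Ω) (X : ℕ → ℕ → Ω → ℝ) (N : ℕ → Ω → ℕ) (n : ℕ) : ℝ :=
  ∫ ω, sumVar P X n (N n ω) ∂P

/-- The Lindeberg fraction
`B_{n,k}^{-2} ∑_{j ≤ k} ∫_{|x - μ_{n,j}| > ε B_{n,k}} (x - μ_{n,j})^2 dF_{n,j}(x)`,
where `F_{n,j}` is the law of `X_{n,j}`. It is `0` for `k = 0`. -/
def lindebergFraction (P : Measure Ω) (X : ℕ → ℕ → Ω → ℝ) (ε : ℝ) (n k : ℕ) : ℝ :=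
  (∑ j ∈ Finset.range k,
    ∫ x in {x : ℝ | ε * √(sumVar P X n k) < |x - ∫ ω, X n j ω ∂P|},
      (x - ∫ ω, X n j ω ∂P) ^ 2 ∂(P.map (X n j))) / sumVar P X n k

/-- The random Lindeberg condition: for every `ε > 0` the expectation of the Lindeberg fraction
at the random index `N_n` tends to `0`. -/
def RandomLindeberg (P : Measure Ω) (X : ℕ → ℕ → Ω → ℝ) (N : ℕ → Ω → ℕ) : Prop :=
  ∀ ε : ℝ, 0 < ε →
    Tendsto (fun n : ℕ => ∫ ω, lindebergFraction P X ε n (N n ω) ∂P) atTop (𝓝 0)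

/-- Convergence in distribution of `Y_n` to a random variable with law `ν`; the limit variable
is realized as the identity on `(ℝ, ν)`. -/
def ConvergesToLaw (P : Measure Ω) [IsProbabilityMeasure P] (Y : ℕ → Ω → ℝ)
    (ν : ProbabilityMeasure ℝ) : Prop :=
  TendstoInDistribution Y atTop (id : ℝ → ℝ) (fun _ => P) (ν : Measure ℝ)

/-- The standard normal distribution function `Φ`. -/
def stdNormalCDF (x : ℝ) : ℝ := cdf (gaussianReal 0 1) x

/-- `Φ((x - α u) / √u)` for `u > 0`. For `u = 0` the normal law with mean `α u` and variance `u` is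
the point mass at `0`, and the value is its mass on `(-∞, x)`. (Negative `u` do not occur with
positive probability under a limit law of nonnegative variables.) -/
def normalMeanVarCDF (α x u : ℝ) : ℝ :=
  if 0 < u then stdNormalCDF ((x - α * u) / √u) else if 0 < x then 1 else 0

/-- `P(Z < x) = E Φ((x - α U) / √U)` for all real `x`, where `Z` has law `ζ` and `U` has
law `ν`. -/
def IsNormalVarianceMeanMixture (α : ℝ) (ζ ν : ProbabilityMeasure ℝ) : Prop :=
  ∀ x : ℝ, (ζ : Measure ℝ).real (Set.Iio x) = ∫ u, normalMeanVarCDF α x u ∂(ν : Measure ℝ)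

end RandomSums

end

/-!
Let `D n` be the mean of `B_{n,N_n}²` and `U n = B_{n,N_n}² / D n`, so that `U n ≥ 0` has mean `1`.

By condition (i) the drift of `S_{n,k} / √(D n)` is `a n * u` with `u = B_{n,k}² / D n`. Lindeberg's
comparison of characteristic functions, kept in quantitative form
(`norm_charFun_partialSum_sub_le`), bounds the distance between the characteristic function of
`S_{n,k} / √(D n)` at `t` and `exp ((i t a n - t² / 2) u)` by a multiple of the Lindeberg fraction
plus `ε + ε²`, with a factor depending only on `t² u`. Since `N n` is independent of each
`S_{n,k}`, the characteristic function of the random sum is the average of the previous ones over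
the index. Discarding the event `U n > M`, of probability at most `1 / M`, the random Lindeberg
condition and `a n → α` show that the random sum and the normal mixture with mixing law that of
`U n` have asymptotically equal characteristic functions (`tendsto_charFun_randomSum_sub`).

If `U n` converges, Lévy's theorem gives the convergence of the random sums, because
`u ↦ exp ((i t α - t² / 2) u)` is bounded and continuous on `[0, ∞)`. Conversely, the laws of `U n`
are tight, and by Prokhorov's theorem they have limit points. The mixture over any limit point is
the law of `Z`, and a mixture determines its mixing law on `[0, ∞)` (`normalMixture_injOn`): its
characteristic function is the Laplace transform of the mixing law along a parabola in the left
half-plane, where this transform is analytic. So there is exactly one limit point.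
-/

noncomputable section

namespace RandomSums

/-! ### A quantitative Lindeberg estimate -/

lemma norm_cexp_mul_I_sub_taylor_le (x : ℝ) :
    ‖Complex.exp (x * Complex.I) - (1 + x * Complex.I - x ^ 2 / 2)‖ ≤ 4 * x ^ 2 ∧
    ‖Complex.exp (x * Complex.I) - (1 + x * Complex.I - x ^ 2 / 2)‖ ≤ 4 * |x| ^ 3 := by
  rcases le_or_gt |x| 1 with hx | hx
  · have h := Complex.exp_bound (x := x * Complex.I) (by simpa using hx) (n := 3) (by norm_num)
    have e : ∑ m ∈ Finset.range 3, ((x : ℂ) * Complex.I) ^ m / (m.factorial : ℂ)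
        = 1 + x * Complex.I - x ^ 2 / 2 := by
      simp only [Finset.sum_range_succ, Finset.range_zero, Finset.sum_empty, mul_pow,
        Complex.I_sq, Nat.factorial]
      push_cast
      ring
    rw [e] at h
    have h2 : ‖(x : ℂ) * Complex.I‖ ^ 3 * (((Nat.succ 3 : ℕ) : ℝ) *
        (((Nat.factorial 3 : ℕ) : ℝ) * ((3 : ℕ) : ℝ))⁻¹) ≤ |x| ^ 3 := by
      simp only [norm_mul, Complex.norm_real, Complex.norm_I, Real.norm_eq_abs, mul_one]
      have : (0 : ℝ) ≤ |x| ^ 3 := by positivity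
      norm_num [Nat.factorial]
      linarith
    have h3 : |x| ^ 3 ≤ x ^ 2 := by
      rw [← sq_abs x]
      exact pow_le_pow_of_le_one (abs_nonneg x) hx (by norm_num)
    have h4 : (0 : ℝ) ≤ |x| ^ 3 := by positivity
    constructor <;> nlinarith [h, h2]
  · have h : ‖Complex.exp (x * Complex.I) - (1 + x * Complex.I - x ^ 2 / 2)‖
        ≤ 1 + (1 + |x| + x ^ 2 / 2) := by
      refine (norm_sub_le _ _).trans (add_le_add (Complex.norm_exp_ofReal_mul_I x).le ?_)
      refine (norm_sub_le _ _).trans (add_le_add ((norm_add_le _ _).trans ?_) ?_)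
      · simp
      · simp
    have h2 : |x| ≤ x ^ 2 := by rw [← sq_abs x]; nlinarith
    have h3 : x ^ 2 ≤ |x| ^ 3 := by
      rw [← sq_abs x]
      exact pow_le_pow_right₀ hx.le (by norm_num)
    have h4 : (1 : ℝ) ≤ x ^ 2 := hx.le.trans h2
    constructor <;> linarith

lemma abs_exp_neg_sub_one_sub_le {x : ℝ} (hx : 0 ≤ x) : |Real.exp (-x) - (1 - x)| ≤ x ^ 2 := by
  have h1 := Real.add_one_le_exp (-x)
  rw [abs_of_nonneg (by linarith)]
  rcases le_or_gt x 1 with h | h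
  · have := Real.norm_exp_sub_one_sub_id_le (x := -x) (by simpa [abs_of_nonneg hx] using h)
    have h2 := le_abs_self (Real.exp (-x) - 1 - -x)
    simp only [Real.norm_eq_abs, sq_abs, abs_neg] at this
    nlinarith
  · have : Real.exp (-x) ≤ 1 := Real.exp_le_one_iff.2 (by linarith)
    nlinarith

lemma norm_prod_sub_prod_le {ι : Type*} (s : Finset ι) (f g : ι → ℂ)
    (hf : ∀ i ∈ s, ‖f i‖ ≤ 1) (hg : ∀ i ∈ s, ‖g i‖ ≤ 1) :
    ‖∏ i ∈ s, f i - ∏ i ∈ s, g i‖ ≤ ∑ i ∈ s, ‖f i - g i‖ := by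
  classical
  induction s using Finset.induction_on with
  | empty => simp
  | insert i s hi ih =>
    rw [Finset.prod_insert hi, Finset.prod_insert hi, Finset.sum_insert hi]
    have e : f i * ∏ j ∈ s, f j - g i * ∏ j ∈ s, g j =
        (f i - g i) * ∏ j ∈ s, f j + g i * (∏ j ∈ s, f j - ∏ j ∈ s, g j) := by ring
    rw [e]
    have hp : ‖∏ j ∈ s, f j‖ ≤ 1 := by
      rw [norm_prod]
      exact Finset.prod_le_one (fun _ _ => norm_nonneg _)
        fun j hj => hf j (Finset.mem_insert_of_mem hj)
    refine (norm_add_le _ _).trans (add_le_add ?_ ?_)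
    · rw [norm_mul]
      exact mul_le_of_le_one_right (norm_nonneg _) hp
    · rw [norm_mul]
      exact (mul_le_of_le_one_left (norm_nonneg _) (hg i (Finset.mem_insert_self _ _))).trans
        (ih (fun j hj => hf j (Finset.mem_insert_of_mem hj))
          fun j hj => hg j (Finset.mem_insert_of_mem hj))

section
variable {Ω : Type*} [MeasurableSpace Ω]

/-- The second-order expansion of the characteristic function of a centred square-integrable
variable. The remainder is split at the level `δ`, the quadratic bound being used above it and the
cubic bound below it. -/
lemma norm_charFun_sub_le {P : Measure Ω} [IsProbabilityMeasure P] {Y : Ω → ℝ} (hm : Measurable Y)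
    (hY : MemLp Y 2 P) (h0 : ∫ ω, Y ω ∂P = 0) (t : ℝ) {δ : ℝ} (hδ : 0 ≤ δ) :
    ‖charFun (P.map Y) t - (1 - t ^ 2 * (∫ ω, Y ω ^ 2 ∂P : ℝ) / 2)‖ ≤
      4 * t ^ 2 * ∫ ω in {ω | δ < |Y ω|}, Y ω ^ 2 ∂P + 4 * |t| ^ 3 * δ * ∫ ω, Y ω ^ 2 ∂P := by
  have hsq : Integrable (fun ω => Y ω ^ 2) P := hY.integrable_sq
  have hint : Integrable Y P := hY.integrable (by norm_num)
  have hset : MeasurableSet {ω | δ < |Y ω|} := measurableSet_lt measurable_const hm.abs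
  rw [charFun_apply_real, integral_map hm.aemeasurable (by fun_prop)]
  have hexp : Integrable (fun ω => Complex.exp (t * Y ω * Complex.I)) P := by
    refine Integrable.of_bound (C := 1) (by fun_prop) (ae_of_all _ fun ω => ?_)
    rw [← Complex.ofReal_mul, Complex.norm_exp_ofReal_mul_I]
  have hi1 : Integrable (fun ω => (t : ℂ) * Y ω * Complex.I) P :=
    (hint.ofReal.const_mul _).mul_const _
  have hi2 : Integrable (fun ω => (t : ℂ) ^ 2 * ((Y ω ^ 2 : ℝ) : ℂ) / 2) P :=
    (hsq.ofReal.const_mul _).div_const _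
  have hi0 : Integrable (fun ω => 1 + (t : ℂ) * Y ω * Complex.I) P :=
    (integrable_const _).add hi1
  have hpi : Integrable (fun ω => 1 + (t : ℂ) * Y ω * Complex.I -
      (t : ℂ) ^ 2 * ((Y ω ^ 2 : ℝ) : ℂ) / 2) P := hi0.sub hi2
  have hpoly : ∫ ω, (1 + (t : ℂ) * Y ω * Complex.I - (t : ℂ) ^ 2 * ((Y ω ^ 2 : ℝ) : ℂ) / 2) ∂P
      = 1 - (t : ℂ) ^ 2 * ((∫ ω, Y ω ^ 2 ∂P : ℝ) : ℂ) / 2 := by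
    rw [integral_sub hi0 hi2, integral_add (integrable_const _) hi1,
      integral_mul_const, integral_const_mul, integral_div, integral_const_mul,
      integral_complex_ofReal, integral_complex_ofReal, h0]
    simp
  rw [← hpoly, ← integral_sub hexp hpi]
  have hind : Integrable ({ω | δ < |Y ω|}.indicator fun ω => Y ω ^ 2) P := hsq.indicator hset
  rw [← integral_indicator hset, ← integral_const_mul, ← integral_const_mul, ← integral_add
    (hind.const_mul _) (hsq.const_mul _)]
  refine norm_integral_le_of_norm_le ((hind.const_mul _).add (hsq.const_mul _))
    (ae_of_all _ fun ω => ?_)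
  have ht := norm_cexp_mul_I_sub_taylor_le (t * Y ω)
  have e : (Complex.exp (t * Y ω * Complex.I) -
      (1 + t * Y ω * Complex.I - (t : ℂ) ^ 2 * ((Y ω ^ 2 : ℝ) : ℂ) / 2)) =
      Complex.exp ((t * Y ω : ℝ) * Complex.I) -
        (1 + (t * Y ω : ℝ) * Complex.I - ((t * Y ω : ℝ) : ℂ) ^ 2 / 2) := by
    push_cast; ring_nf
  rw [e]
  by_cases h : δ < |Y ω|
  · rw [Set.indicator_of_mem (by exact h)]
    refine ht.1.trans ?_
    have : 0 ≤ 4 * |t| ^ 3 * δ * Y ω ^ 2 := by positivity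
    nlinarith
  · rw [Set.indicator_of_notMem (by exact h)]
    refine ht.2.trans ?_
    rw [abs_mul, mul_pow, pow_succ |Y ω| 2, sq_abs, mul_zero, zero_add]
    have h1 : Y ω ^ 2 * |Y ω| ≤ Y ω ^ 2 * δ :=
      mul_le_mul_of_nonneg_left (not_lt.1 h) (sq_nonneg _)
    calc 4 * (|t| ^ 3 * (Y ω ^ 2 * |Y ω|)) ≤ 4 * (|t| ^ 3 * (Y ω ^ 2 * δ)) := by gcongr
      _ = _ := by ring

lemma integral_sq_le_add_setIntegral {P : Measure Ω} [IsProbabilityMeasure P] {Y : Ω → ℝ}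
    (hm : Measurable Y) (hY : MemLp Y 2 P) (δ : ℝ) :
    ∫ ω, Y ω ^ 2 ∂P ≤ δ ^ 2 + ∫ ω in {ω | δ < |Y ω|}, Y ω ^ 2 ∂P := by
  have hsq : Integrable (fun ω => Y ω ^ 2) P := hY.integrable_sq
  have hset : MeasurableSet {ω | δ < |Y ω|} := measurableSet_lt measurable_const hm.abs
  have hind : Integrable ({ω | δ < |Y ω|}.indicator fun ω => Y ω ^ 2) P := hsq.indicator hset
  have hc : δ ^ 2 = ∫ _, δ ^ 2 ∂P := by simp
  rw [hc, ← integral_indicator hset, ← integral_add (integrable_const _) hind]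
  refine integral_mono hsq ((integrable_const _).add hind) fun ω => ?_
  by_cases h : δ < |Y ω|
  · simp only
    rw [Set.indicator_of_mem (by exact h)]
    nlinarith [sq_nonneg δ]
  · simp only
    rw [Set.indicator_of_notMem (by exact h), add_zero, ← sq_abs (Y ω)]
    exact pow_le_pow_left₀ (abs_nonneg _) (not_lt.1 h) 2

/-- Lindeberg's comparison for a finite sum of independent centred variables, in quantitative
form. -/
lemma norm_charFun_sum_sub_exp_le {P : Measure Ω} [IsProbabilityMeasure P] {Y : ℕ → Ω → ℝ}
    (hm : ∀ j, Measurable (Y j)) (hY : ∀ j, MemLp (Y j) 2 P) (h0 : ∀ j, ∫ ω, Y j ω ∂P = 0)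
    (hind : iIndepFun Y P) (k : ℕ) (t : ℝ) {δ : ℝ} (hδ : 0 ≤ δ) :
    ‖charFun (P.map fun ω => ∑ j ∈ Finset.range k, Y j ω) t -
        Real.exp (-(t ^ 2 * (∑ j ∈ Finset.range k, ∫ ω, Y j ω ^ 2 ∂P) / 2))‖ ≤
      4 * t ^ 2 * (∑ j ∈ Finset.range k, ∫ ω in {ω | δ < |Y j ω|}, Y j ω ^ 2 ∂P) +
      4 * |t| ^ 3 * δ * (∑ j ∈ Finset.range k, ∫ ω, Y j ω ^ 2 ∂P) +
      t ^ 4 / 4 * (δ ^ 2 + ∑ j ∈ Finset.range k, ∫ ω in {ω | δ < |Y j ω|}, Y j ω ^ 2 ∂P) *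
        (∑ j ∈ Finset.range k, ∫ ω, Y j ω ^ 2 ∂P) := by
  set v : ℕ → ℝ := fun j => ∫ ω, Y j ω ^ 2 ∂P with hv
  set T : ℕ → ℝ := fun j => ∫ ω in {ω | δ < |Y j ω|}, Y j ω ^ 2 ∂P with hT
  have hv0 : ∀ j, 0 ≤ v j := fun j => integral_nonneg fun ω => sq_nonneg _
  have hT0 : ∀ j, 0 ≤ T j := fun j => integral_nonneg fun ω => sq_nonneg _
  have hprod : charFun (P.map fun ω => ∑ j ∈ Finset.range k, Y j ω) =
      ∏ j ∈ Finset.range k, charFun (P.map (Y j)) :=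
    iIndepFun.charFun_map_fun_finsetSum_eq_prod (fun j _ => (hm j).aemeasurable) (hind.restrict _)
  have hexp : ((Real.exp (-(t ^ 2 * (∑ j ∈ Finset.range k, v j) / 2)) : ℝ) : ℂ) =
      ∏ j ∈ Finset.range k, ((Real.exp (-(t ^ 2 * v j / 2)) : ℝ) : ℂ) := by
    rw [← Complex.ofReal_prod, ← Real.exp_sum, Finset.mul_sum, Finset.sum_div,
      Finset.sum_neg_distrib]
  rw [hprod, hexp, Finset.prod_apply]
  have : ∀ j, IsProbabilityMeasure (P.map (Y j)) := fun j =>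
    Measure.isProbabilityMeasure_map (hm j).aemeasurable
  refine (norm_prod_sub_prod_le _ _ _ (fun j _ => norm_charFun_le_one _) fun j _ => ?_).trans ?_
  · rw [Complex.norm_real, Real.norm_eq_abs, abs_of_pos (Real.exp_pos _), Real.exp_le_one_iff,
      neg_nonpos]
    have := hv0 j
    positivity
  have key : ∀ j ∈ Finset.range k,
      ‖charFun (P.map (Y j)) t - ((Real.exp (-(t ^ 2 * v j / 2)) : ℝ) : ℂ)‖ ≤
      4 * t ^ 2 * T j + 4 * |t| ^ 3 * δ * v j +
        t ^ 4 / 4 * (δ ^ 2 + ∑ i ∈ Finset.range k, T i) * v j := by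
    intro j hj
    have h1 := norm_charFun_sub_le (hm j) (hY j) (h0 j) t hδ
    have h2 := abs_exp_neg_sub_one_sub_le (x := t ^ 2 * v j / 2) (by have := hv0 j; positivity)
    have h3 : v j ≤ δ ^ 2 + ∑ i ∈ Finset.range k, T i :=
      (integral_sq_le_add_setIntegral (hm j) (hY j) δ).trans
        (add_le_add le_rfl (Finset.single_le_sum (f := T) (fun i _ => hT0 i) hj))
    have h4 : (t ^ 2 * v j / 2) ^ 2 ≤
        t ^ 4 / 4 * (δ ^ 2 + ∑ i ∈ Finset.range k, T i) * v j := by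
      calc (t ^ 2 * v j / 2) ^ 2 = t ^ 4 / 4 * v j * v j := by ring
        _ ≤ _ := by
          have := hv0 j
          gcongr
    have h5 : ‖(1 - (t : ℂ) ^ 2 * (v j : ℝ) / 2) - ((Real.exp (-(t ^ 2 * v j / 2)) : ℝ) : ℂ)‖ ≤
        (t ^ 2 * v j / 2) ^ 2 := by
      rw [norm_sub_rev]
      refine le_trans (le_of_eq ?_) h2
      rw [← Real.norm_eq_abs, ← Complex.norm_real]
      push_cast
      rfl
    have h6 := norm_sub_le_norm_sub_add_norm_sub (charFun (P.map (Y j)) t)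
      (1 - (t : ℂ) ^ 2 * (v j : ℝ) / 2) ((Real.exp (-(t ^ 2 * v j / 2)) : ℝ) : ℂ)
    linarith
  refine (Finset.sum_le_sum key).trans (le_of_eq ?_)
  rw [Finset.sum_add_distrib, Finset.sum_add_distrib, ← Finset.mul_sum, ← Finset.mul_sum,
    ← Finset.mul_sum]

end

/-! ### Normal variance-mean mixtures -/

/-- The law of `α U + √U G`, where `U` has law `ν` and `G` is a standard normal variable
independent of `U`. A negative value of `U` is treated as `0`, in accordance with
`normalMeanVarCDF`. -/
def normalMixture (α : ℝ) (ν : ProbabilityMeasure ℝ) : ProbabilityMeasure ℝ :=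
  ⟨((ν : Measure ℝ).prod (gaussianReal 0 1)).map fun p : ℝ × ℝ => α * max p.1 0 + √p.1 * p.2,
    Measure.isProbabilityMeasure_map (by fun_prop)⟩

lemma norm_cexp_drift_le_one (α t : ℝ) {u : ℝ} (hu : 0 ≤ u) :
    ‖Complex.exp ((t * α * Complex.I - t ^ 2 / 2) * (u : ℂ))‖ ≤ 1 := by
  rw [Complex.norm_exp, Real.exp_le_one_iff, Complex.re_mul_ofReal]
  have e : ((t : ℂ) * α * Complex.I - (t : ℂ) ^ 2 / 2).re = -(t ^ 2 / 2) := by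
    simp [← Complex.ofReal_pow]
  rw [e, neg_mul, neg_nonpos]
  positivity

/-- The function `u ↦ exp ((i t α - t² / 2) u)`, continued to the negative half-line by the
constant `1` so as to be bounded. At `u ≥ 0` it is the characteristic function at `t` of the normal
law with mean `α u` and variance `u`. -/
def mixtureKernel (α t : ℝ) : BoundedContinuousFunction ℝ ℂ :=
  BoundedContinuousFunction.ofNormedAddCommGroup
    (fun u => Complex.exp ((t * α * Complex.I - t ^ 2 / 2) * ((max u 0 : ℝ) : ℂ)))
    (by fun_prop) 1 fun u => norm_cexp_drift_le_one α t (le_max_right u 0)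

lemma mixtureKernel_apply (α t u : ℝ) : mixtureKernel α t u =
    Complex.exp ((t * α * Complex.I - t ^ 2 / 2) * ((max u 0 : ℝ) : ℂ)) := rfl

lemma charFun_normalMixture (α t : ℝ) (ν : ProbabilityMeasure ℝ) :
    charFun (normalMixture α ν : Measure ℝ) t = ∫ u, mixtureKernel α t u ∂(ν : Measure ℝ) := by
  have hm : Measurable fun p : ℝ × ℝ => α * max p.1 0 + √p.1 * p.2 := by fun_prop
  simp only [normalMixture, ProbabilityMeasure.coe_mk]
  rw [charFun_apply_real, integral_map hm.aemeasurable (by fun_prop), integral_prod]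
  · refine integral_congr_ae (ae_of_all _ fun u => ?_)
    have h := charFun_gaussianReal (μ := 0) (v := 1) (t * √u)
    rw [charFun_apply_real] at h
    have e : ∀ x : ℝ, Complex.exp (t * ((α * max u 0 + √u * x : ℝ) : ℂ) * Complex.I) =
        Complex.exp (t * α * Complex.I * ((max u 0 : ℝ) : ℂ)) *
          Complex.exp (((t * √u : ℝ) : ℂ) * x * Complex.I) := by
      intro x
      rw [← Complex.exp_add]
      push_cast
      ring_nf
    simp only [e]
    rw [integral_const_mul, h, ← Complex.exp_add, mixtureKernel_apply]
    have hs : ((√u : ℝ) : ℂ) ^ 2 = ((max u 0 : ℝ) : ℂ) := by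
      rw [← Complex.ofReal_pow, Real.sq_sqrt']
    congr 1
    push_cast at hs ⊢
    rw [mul_pow, hs]
    ring
  · refine Integrable.of_bound (C := 1) (by fun_prop) (ae_of_all _ fun p => ?_)
    rw [← Complex.ofReal_mul, Complex.norm_exp_ofReal_mul_I]

lemma normalMixture_real_Iio (α x : ℝ) (ν : ProbabilityMeasure ℝ) :
    (normalMixture α ν : Measure ℝ).real (Set.Iio x) =
      ∫ u, normalMeanVarCDF α x u ∂(ν : Measure ℝ) := by
  have hm : Measurable fun p : ℝ × ℝ => α * max p.1 0 + √p.1 * p.2 := by fun_prop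
  simp only [normalMixture, ProbabilityMeasure.coe_mk]
  rw [measureReal_def, Measure.map_apply hm measurableSet_Iio,
    Measure.prod_apply (hm measurableSet_Iio), ← integral_toReal]
  · refine integral_congr_ae (ae_of_all _ fun u => ?_)
    simp only [normalMeanVarCDF]
    split_ifs with hu hx
    · have hs : 0 < √u := Real.sqrt_pos.2 hu
      have e : Prod.mk u ⁻¹' ((fun p : ℝ × ℝ => α * max p.1 0 + √p.1 * p.2) ⁻¹' Set.Iio x) =
          Set.Iio ((x - α * u) / √u) := by
        ext y
        simp only [Set.mem_preimage, Set.mem_Iio, max_eq_left hu.le]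
        rw [lt_div_iff₀ hs]
        constructor <;> intro h <;> linarith
      have : NullSingletonClass (gaussianReal 0 1) :=
        nullSingletonClass_gaussianReal one_ne_zero
      rw [e, stdNormalCDF, cdf_eq_real, measureReal_def, measure_congr Iio_ae_eq_Iic]
    · have e : Prod.mk u ⁻¹' ((fun p : ℝ × ℝ => α * max p.1 0 + √p.1 * p.2) ⁻¹' Set.Iio x) =
          Set.univ := by
        ext y
        simpa [max_eq_right (not_lt.1 hu), Real.sqrt_eq_zero_of_nonpos (not_lt.1 hu)] using hx
      rw [e, measure_univ, ENNReal.toReal_one]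
    · have e : Prod.mk u ⁻¹' ((fun p : ℝ × ℝ => α * max p.1 0 + √p.1 * p.2) ⁻¹' Set.Iio x) =
          ∅ := by
        ext y
        simpa [max_eq_right (not_lt.1 hu), Real.sqrt_eq_zero_of_nonpos (not_lt.1 hu)] using hx
      rw [e, measure_empty, ENNReal.toReal_zero]
  · exact (measurable_measure_prodMk_left (hm measurableSet_Iio)).aemeasurable
  · exact ae_of_all _ fun u => measure_lt_top _ _

lemma isNormalVarianceMeanMixture_iff {α : ℝ} {ζ ν : ProbabilityMeasure ℝ} :
    IsNormalVarianceMeanMixture α ζ ν ↔ normalMixture α ν = ζ := by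
  constructor
  · intro h
    refine Subtype.ext (show (normalMixture α ν : Measure ℝ) = ζ from
      Measure.ext_of_Ici _ _ fun x => ?_)
    have hx := (normalMixture_real_Iio α x ν).trans (h x).symm
    rw [measureReal_def, measureReal_def,
      ENNReal.toReal_eq_toReal_iff' (measure_ne_top _ _) (measure_ne_top _ _)] at hx
    rw [← Set.compl_Iio]
    rw [prob_compl_eq_one_sub measurableSet_Iio, prob_compl_eq_one_sub measurableSet_Iio, hx]
  · rintro rfl x
    exact normalMixture_real_Iio α x ν

lemma continuous_charFun_normalMixture (α t : ℝ) :
    Continuous fun ν : ProbabilityMeasure ℝ => charFun (normalMixture α ν : Measure ℝ) t := by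
  simp only [charFun_normalMixture]
  rw [continuous_iff_continuousAt]
  intro ν
  exact (ProbabilityMeasure.tendsto_iff_forall_integral_rclike_tendsto ℂ).1 tendsto_id
    (mixtureKernel α t)

lemma Iio_subset_interior_integrableExpSet {ν : Measure ℝ} [IsProbabilityMeasure ν]
    (h : ν (Set.Iio 0) = 0) : Set.Iio 0 ⊆ interior (integrableExpSet id ν) := by
  refine interior_maximal (fun s hs => ?_) isOpen_Iio
  have h' : ∀ᵐ u ∂ν, 0 ≤ u := by
    rw [ae_iff]
    simpa [Set.Iio] using h
  refine Integrable.of_bound (C := 1) (by fun_prop) ?_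
  filter_upwards [h'] with u hu
  rw [Real.norm_eq_abs, Real.abs_exp, Real.exp_le_one_iff]
  exact mul_nonpos_of_nonpos_of_nonneg (le_of_lt hs) hu

lemma tendsto_complexMGF_charFun {ν : Measure ℝ} [IsProbabilityMeasure ν]
    (h : ν (Set.Iio 0) = 0) (s : ℝ) :
    Tendsto (fun r : ℝ => complexMGF id ν (r + s * Complex.I)) (𝓝[<] 0) (𝓝 (charFun ν s)) := by
  rw [← complexMGF_id_mul_I]
  have h' : ∀ᵐ u ∂ν, 0 ≤ u := by
    rw [ae_iff]
    simpa [Set.Iio] using h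
  refine tendsto_integral_filter_of_dominated_convergence (fun _ => 1)
    (Eventually.of_forall fun r => by fun_prop) ?_ (integrable_const _) ?_
  · filter_upwards [self_mem_nhdsWithin] with r hr
    filter_upwards [h'] with u hu
    rw [Complex.norm_exp, Real.exp_le_one_iff, Complex.re_mul_ofReal]
    simpa using mul_nonpos_of_nonpos_of_nonneg (le_of_lt hr) hu
  · refine ae_of_all _ fun u => ?_
    have : Continuous fun r : ℝ => Complex.exp (((r : ℂ) + s * Complex.I) * ((id u : ℝ) : ℂ)) := by
      fun_prop
    have h2 := this.tendsto 0
    simp only [Complex.ofReal_zero, zero_add] at h2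
    exact h2.mono_left nhdsWithin_le_nhds

/-- Identifiability of normal variance-mean mixtures. The characteristic function of the mixture
gives the Laplace transform of the mixing law on the curve `t ↦ i t α - t² / 2`; this curve has
accumulation points in the open left half-plane, where the transform is analytic. -/
lemma normalMixture_injOn (α : ℝ) :
    Set.InjOn (normalMixture α) {ν | (ν : Measure ℝ) (Set.Iio 0) = 0} := by
  intro ν hν ν' hν' heq
  have hν : (ν : Measure ℝ) (Set.Iio 0) = 0 := hν
  have hν' : (ν' : Measure ℝ) (Set.Iio 0) = 0 := hν'
  set c : ℝ → ℂ := fun t => t * α * Complex.I - t ^ 2 / 2 with hc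
  have hre : ∀ t, (c t).re = -(t ^ 2 / 2) := fun t => by simp [hc, ← Complex.ofReal_pow]
  have hmgf : ∀ (ρ : ProbabilityMeasure ℝ), (ρ : Measure ℝ) (Set.Iio 0) = 0 → ∀ t,
      complexMGF id (ρ : Measure ℝ) (c t) = charFun (normalMixture α ρ : Measure ℝ) t := by
    intro ρ hρ t
    rw [charFun_normalMixture]
    have h' : ∀ᵐ u ∂(ρ : Measure ℝ), 0 ≤ u := by
      rw [ae_iff]
      simpa [Set.Iio] using hρ
    refine integral_congr_ae ?_
    filter_upwards [h'] with u hu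
    rw [mixtureKernel_apply, max_eq_left hu, id]
  set U : Set ℂ := {z | z.re < 0} with hU
  have han : ∀ (ρ : ProbabilityMeasure ℝ), (ρ : Measure ℝ) (Set.Iio 0) = 0 →
      AnalyticOnNhd ℂ (complexMGF id (ρ : Measure ℝ)) U := fun ρ hρ =>
    analyticOnNhd_complexMGF.mono fun z hz => Iio_subset_interior_integrableExpSet hρ hz
  have hUconn : IsPreconnected U := (convex_halfSpace_re_lt 0).isPreconnected
  have hfreq : ∃ᶠ z in 𝓝[≠] (c 1),
      complexMGF id (ν : Measure ℝ) z = complexMGF id (ν' : Measure ℝ) z := by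
    -- The real part `-t² / 2` is injective on `t > 0`, so `c 1` is a genuine accumulation point.
    have ht : Tendsto c (𝓝[>] 1) (𝓝[≠] (c 1)) := by
      refine tendsto_nhdsWithin_iff.2 ⟨?_, ?_⟩
      · have : Continuous c := by fun_prop
        exact (this.tendsto 1).mono_left nhdsWithin_le_nhds
      · filter_upwards [self_mem_nhdsWithin] with t ht h
        have h2 := congrArg Complex.re (show c t = c 1 from h)
        rw [hre, hre] at h2
        have : (1 : ℝ) < t := ht
        nlinarith
    refine ht.frequently (Eventually.of_forall fun t => ?_).frequently
    rw [hmgf ν hν, hmgf ν' hν', heq]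
  have heqOn := (han ν hν).eqOn_of_preconnected_of_frequently_eq (han ν' hν') hUconn
    (show c 1 ∈ U by simp [hU, hre]) hfreq
  refine Subtype.ext (show (ν : Measure ℝ) = ν' from Measure.ext_of_charFun (funext fun s => ?_))
  refine tendsto_nhds_unique (tendsto_complexMGF_charFun hν s) ?_
  refine (tendsto_complexMGF_charFun hν' s).congr' ?_
  filter_upwards [self_mem_nhdsWithin] with r hr
  refine (heqOn ?_).symm
  simpa [hU] using hr

/-! ### Sums with a random index -/

section
variable {Ω : Type*} [MeasurableSpace Ω]

lemma measurable_randomIndex {E : Type*} [MeasurableSpace E] {N : Ω → ℕ} {S : ℕ → Ω → E}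
    (hN : Measurable N) (hS : ∀ k, Measurable (S k)) : Measurable fun ω => S (N ω) ω :=
  (measurable_from_prod_countable_right (f := fun p : ℕ × Ω => S p.1 p.2) hS).comp
    (hN.prodMk measurable_id)

/-- Conditioning on the index: only the independence of `N` from each single `S k` is used. -/
lemma integral_randomIndex {P : Measure Ω} [IsProbabilityMeasure P] {N : Ω → ℕ} {S : ℕ → Ω → ℝ}
    (hN : Measurable N) (hS : ∀ k, Measurable (S k)) (hind : ∀ k, IndepFun N (S k) P)
    {f : ℝ → ℂ} (hf : Measurable f) (hf1 : ∀ x, ‖f x‖ ≤ 1) :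
    ∫ ω, f (S (N ω) ω) ∂P = ∫ ω, (∫ ω', f (S (N ω) ω') ∂P) ∂P := by
  have hA : ∀ k, MeasurableSet (N ⁻¹' {k}) := fun k => hN (measurableSet_singleton k)
  have hdisj : Pairwise (Function.onFun Disjoint fun k => N ⁻¹' {k}) := fun i j hij =>
    Disjoint.preimage _ (Set.disjoint_singleton.2 hij)
  have hU : ⋃ k, N ⁻¹' {k} = Set.univ := by
    rw [← Set.preimage_iUnion, Set.iUnion_of_singleton, Set.preimage_univ]
  have hi1 : Integrable (fun ω => f (S (N ω) ω)) P :=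
    Integrable.of_bound (C := 1)
      (hf.comp (measurable_randomIndex hN hS)).aestronglyMeasurable (ae_of_all _ fun ω => hf1 _)
  have hm2 : Measurable fun ω => ∫ ω', f (S (N ω) ω') ∂P :=
    (measurable_from_top (f := fun k : ℕ => ∫ ω', f (S k ω') ∂P)).comp hN
  have hi2 : Integrable (fun ω => ∫ ω', f (S (N ω) ω') ∂P) P :=
    Integrable.of_bound (C := 1) hm2.aestronglyMeasurable (ae_of_all _ fun ω => by
      simpa using norm_integral_le_of_norm_le_const (μ := P) (C := 1)
        (ae_of_all _ fun ω' => hf1 (S (N ω) ω')))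
  rw [← setIntegral_univ, ← setIntegral_univ (f := fun ω => ∫ ω', f (S (N ω) ω') ∂P), ← hU,
    integral_iUnion hA hdisj hi1.integrableOn, integral_iUnion hA hdisj hi2.integrableOn]
  refine tsum_congr fun k => ?_
  have e1 : ∫ ω in N ⁻¹' {k}, f (S (N ω) ω) ∂P = ∫ ω in N ⁻¹' {k}, f (S k ω) ∂P :=
    setIntegral_congr_fun (hA k) fun ω (hω : N ω = k) => by simp only [hω]
  have e2 : ∫ ω in N ⁻¹' {k}, (∫ ω', f (S (N ω) ω') ∂P) ∂P =
      ∫ ω in N ⁻¹' {k}, (∫ ω', f (S k ω') ∂P) ∂P :=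
    setIntegral_congr_fun (hA k) fun ω (hω : N ω = k) => by simp only [hω]
  rw [e1, e2, setIntegral_const, ← integral_indicator (hA k)]
  have e3 : (N ⁻¹' {k}).indicator (fun ω => f (S k ω)) =
      fun ω => (({k} : Set ℕ).indicator (fun _ => (1 : ℂ)) (N ω)) * f (S k ω) := by
    ext ω
    by_cases h : N ω = k <;> simp [Set.indicator, h]
  rw [e3, (hind k).integral_fun_comp_mul_comp (f := ({k} : Set ℕ).indicator fun _ => (1 : ℂ))
    (g := f) hN.aemeasurable (hS k).aemeasurable
    (measurable_from_top.aestronglyMeasurable) hf.aestronglyMeasurable]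
  have e4 : (fun ω => ({k} : Set ℕ).indicator (fun _ => (1 : ℂ)) (N ω)) =
      (N ⁻¹' {k}).indicator fun _ => (1 : ℂ) := by
    ext ω
    simp [Set.indicator]
  rw [e4, integral_indicator_const _ (hA k)]
  simp

variable {P : Measure Ω} {X : ℕ → ℕ → Ω → ℝ}

lemma measurable_partialSum (hX : ∀ n j, Measurable (X n j)) (n k : ℕ) :
    Measurable (partialSum X n k) :=
  Finset.measurable_fun_sum _ fun j _ => hX n j

lemma sumVar_nonneg (n k : ℕ) : 0 ≤ sumVar P X n k :=
  Finset.sum_nonneg fun _ _ => variance_nonneg _ _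

lemma setIntegral_map_sub_mean {Y : Ω → ℝ} (hY : Measurable Y) (m δ : ℝ) :
    ∫ x in {x : ℝ | δ < |x - m|}, (x - m) ^ 2 ∂(P.map Y) =
      ∫ ω in {ω | δ < |Y ω - m|}, (Y ω - m) ^ 2 ∂P := by
  rw [setIntegral_map (measurableSet_lt measurable_const (by fun_prop)) (by fun_prop)
    hY.aemeasurable]
  rfl

lemma lindebergFraction_nonneg (ε : ℝ) (n k : ℕ) : 0 ≤ lindebergFraction P X ε n k :=
  div_nonneg (Finset.sum_nonneg fun _ _ => integral_nonneg fun _ => sq_nonneg _)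
    (sumVar_nonneg n k)

/-- The case `k = 0`, where the quotient is `0 / 0`, is included. -/
lemma lindebergFraction_mul_sumVar (hX : ∀ n j, Measurable (X n j))
    (hpos : ∀ n j, 0 < Var[X n j; P]) (ε : ℝ) (n k : ℕ) :
    lindebergFraction P X ε n k * sumVar P X n k =
      ∑ j ∈ Finset.range k, ∫ ω in {ω | ε * √(sumVar P X n k) < |X n j ω - ∫ ω, X n j ω ∂P|},
        (X n j ω - ∫ ω, X n j ω ∂P) ^ 2 ∂P := by
  simp only [lindebergFraction, fun j => setIntegral_map_sub_mean (P := P) (hX n j)]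
  rcases Nat.eq_zero_or_pos k with rfl | hk
  · simp
  · exact div_mul_cancel₀ _ (Finset.sum_pos (fun j _ => hpos n j)
      (Finset.nonempty_range_iff.2 hk.ne')).ne'

variable [IsProbabilityMeasure P]

lemma lindebergFraction_le_one (hX : ∀ n j, Measurable (X n j)) (hX2 : ∀ n j, MemLp (X n j) 2 P)
    (ε : ℝ) (n k : ℕ) : lindebergFraction P X ε n k ≤ 1 := by
  refine div_le_one_of_le₀ (Finset.sum_le_sum fun j _ => ?_) (sumVar_nonneg n k)
  rw [setIntegral_map_sub_mean (hX n j), variance_eq_integral (hX n j).aemeasurable]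
  exact setIntegral_le_integral ((hX2 n j).sub (memLp_const _)).integrable_sq
    (ae_of_all _ fun _ => sq_nonneg _)

/-- The Lindeberg estimate for `S_{n,k} / √D`, where `u = B_{n,k}² / D`. -/
lemma norm_charFun_partialSum_sub_le (hX : ∀ n j, Measurable (X n j))
    (hX2 : ∀ n j, MemLp (X n j) 2 P) (hpos : ∀ n j, 0 < Var[X n j; P])
    (hind : ∀ n, iIndepFun (X n) P) {D b : ℝ} (hD : 0 < D) {n : ℕ}
    (hmean : ∀ j, ∫ ω, X n j ω ∂P = b * Var[X n j; P] / √D)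
    (k : ℕ) (t : ℝ) {ε : ℝ} (hε : 0 ≤ ε) :
    ‖charFun (P.map (partialSum X n k)) (t / √D) -
        Complex.exp ((t * b * Complex.I - t ^ 2 / 2) * ((sumVar P X n k / D : ℝ) : ℂ))‖ ≤
      4 * (1 + t ^ 2 * (sumVar P X n k / D)) ^ 2 * (lindebergFraction P X ε n k + ε + ε ^ 2) := by
  set V := sumVar P X n k with hV
  set L := lindebergFraction P X ε n k with hL
  have hV0 : 0 ≤ V := sumVar_nonneg n k
  have hL0 : 0 ≤ L := lindebergFraction_nonneg ε n k
  have hsD : 0 < √D := Real.sqrt_pos.2 hD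
  set Y : ℕ → Ω → ℝ := fun j ω => X n j ω - ∫ ω, X n j ω ∂P with hYdef
  have hYm : ∀ j, Measurable (Y j) := fun j => (hX n j).sub_const _
  have hY2 : ∀ j, MemLp (Y j) 2 P := fun j => (hX2 n j).sub (memLp_const _)
  have hY0 : ∀ j, ∫ ω, Y j ω ∂P = 0 := fun j => by
    simp only [hYdef]
    rw [integral_sub ((hX2 n j).integrable (by norm_num)) (integrable_const _)]
    simp
  have hYind : iIndepFun Y P :=
    (hind n).comp (fun j x => x - ∫ ω, X n j ω ∂P) fun j => by fun_prop
  have hvar : ∑ j ∈ Finset.range k, ∫ ω, Y j ω ^ 2 ∂P = V :=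
    Finset.sum_congr rfl fun j _ => (variance_eq_integral (hX n j).aemeasurable).symm
  have hlin := lindebergFraction_mul_sumVar hX hpos ε n k
  have hmain := norm_charFun_sum_sub_exp_le hYm hY2 hY0 hYind k (t / √D)
    (mul_nonneg hε (Real.sqrt_nonneg V))
  rw [hvar, ← hlin, ← hL, ← hV] at hmain
  have hdecomp : partialSum X n k = fun ω => (∑ j ∈ Finset.range k, Y j ω) + b * V / √D := by
    ext ω
    simp only [partialSum, hYdef, Finset.sum_sub_distrib, hmean, hV, sumVar, Finset.mul_sum,
      Finset.sum_div]
    ring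
  have hcf : charFun (P.map (partialSum X n k)) (t / √D) =
      charFun (P.map fun ω => ∑ j ∈ Finset.range k, Y j ω) (t / √D) *
        Complex.exp ((t * b * (V / D) : ℝ) * Complex.I) := by
    have hmY : Measurable fun ω => ∑ j ∈ Finset.range k, Y j ω :=
      Finset.measurable_fun_sum _ fun j _ => hYm j
    rw [charFun_apply_real, charFun_apply_real, integral_map
      (measurable_partialSum hX n k).aemeasurable (by fun_prop),
      integral_map hmY.aemeasurable (by fun_prop), ← integral_mul_const, hdecomp]
    refine integral_congr_ae (ae_of_all _ fun ω => ?_)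
    have e : t * b * (V / D) = t / √D * (b * V / √D) := by
      have : D = √D * √D := (Real.mul_self_sqrt hD.le).symm
      rw [div_mul_div_comm, ← this]
      ring
    simp only [e]
    rw [← Complex.exp_add]
    push_cast
    ring_nf
  have hexp : Complex.exp ((t * b * Complex.I - t ^ 2 / 2) * ((V / D : ℝ) : ℂ)) =
      ((Real.exp (-((t / √D) ^ 2 * V / 2)) : ℝ) : ℂ) *
        Complex.exp ((t * b * (V / D) : ℝ) * Complex.I) := by
    rw [Complex.ofReal_exp, ← Complex.exp_add]
    have : (t / √D) ^ 2 = t ^ 2 / D := by rw [div_pow, Real.sq_sqrt hD.le]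
    rw [this]
    push_cast
    ring_nf
  rw [hcf, hexp, ← sub_mul, norm_mul, Complex.norm_exp_ofReal_mul_I, mul_one]
  refine hmain.trans ?_
  set w := t ^ 2 * (V / D) with hw
  -- The cubic error term carries `w ^ (3 / 2) = q * w`; it is absorbed through `q ≤ 1 + q ^ 2`.
  set q := |t / √D| * √V with hq
  have hq0 : 0 ≤ q := by positivity
  have hw1 : (t / √D) ^ 2 * V = w := by
    rw [div_pow, Real.sq_sqrt hD.le, hw]
    ring
  have hqw : q ^ 2 = w := by rw [hq, mul_pow, sq_abs, Real.sq_sqrt hV0, hw1]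
  have e1 : 4 * (t / √D) ^ 2 * (L * V) = 4 * w * L := by rw [← hw1]; ring
  have e2 : 4 * |t / √D| ^ 3 * (ε * √V) * V = 4 * ε * q * w := by
    rw [← hw1, hq, ← sq_abs (t / √D)]
    ring
  have e3 : (t / √D) ^ 4 / 4 * ((ε * √V) ^ 2 + L * V) * V = w ^ 2 / 4 * (ε ^ 2 + L) := by
    rw [← hw1, mul_pow, Real.sq_sqrt hV0]
    ring
  rw [e1, e2, e3]
  have hw0 : 0 ≤ w := by positivity
  have hqle : q ≤ 1 + w := by nlinarith
  have h1 : 4 * ε * q * w ≤ 4 * ε * (1 + w) * w := by gcongr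
  have h2 : 0 ≤ w * ε := by positivity
  have h3 : 0 ≤ w * L := by positivity
  have h4 : 0 ≤ w ^ 2 * L := by positivity
  have h5 : 0 ≤ w * ε ^ 2 := by positivity
  have h6 : 0 ≤ w ^ 2 * ε ^ 2 := by positivity
  nlinarith [sq_nonneg ε]

lemma norm_cexp_drift_sub_le (b α t : ℝ) {u : ℝ} (hu : 0 ≤ u) :
    ‖Complex.exp ((t * b * Complex.I - t ^ 2 / 2) * (u : ℂ)) -
      Complex.exp ((t * α * Complex.I - t ^ 2 / 2) * (u : ℂ))‖ ≤ |t| * |b - α| * u := by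
  have e : Complex.exp ((t * b * Complex.I - t ^ 2 / 2) * (u : ℂ)) -
      Complex.exp ((t * α * Complex.I - t ^ 2 / 2) * (u : ℂ)) =
      Complex.exp ((t * α * Complex.I - t ^ 2 / 2) * (u : ℂ)) *
        (Complex.exp (Complex.I * (t * (b - α) * u : ℝ)) - 1) := by
    rw [mul_sub, mul_one, ← Complex.exp_add]
    push_cast
    ring_nf
  rw [e, norm_mul]
  refine (mul_le_of_le_one_left (norm_nonneg _) (norm_cexp_drift_le_one α t hu)).trans
    (Real.norm_exp_I_mul_ofReal_sub_one_le.trans (le_of_eq ?_))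
  rw [Real.norm_eq_abs, abs_mul, abs_mul, abs_of_nonneg hu]

end

section
variable {Ω : Type*} [MeasurableSpace Ω] {P : Measure Ω} [IsProbabilityMeasure P]
  {X : ℕ → ℕ → Ω → ℝ} {N : ℕ → Ω → ℕ}

/-- The Lindeberg estimate averaged over the index. The event `B_{n,N_n}² / D_n > M` is discarded
at the cost `2 / M`, by Markov's inequality. -/
lemma norm_charFun_randomSum_sub_le (hX : ∀ n j, Measurable (X n j))
    (hX2 : ∀ n j, MemLp (X n j) 2 P) (hpos : ∀ n j, 0 < Var[X n j; P])
    (hind : ∀ n, iIndepFun (X n) P) (hN : ∀ n, Measurable (N n))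
    (hNind : ∀ n k, IndepFun (N n) (partialSum X n k) P) (n : ℕ)
    (hBint : Integrable (fun ω => sumVar P X n (N n ω)) P) (hD : 0 < meanSumVar P X N n) {b : ℝ}
    (hmean : ∀ j, ∫ ω, X n j ω ∂P = b * Var[X n j; P] / √(meanSumVar P X N n))
    (α t : ℝ) {ε M : ℝ} (hε : 0 ≤ ε) (hM : 0 < M) :
    ‖charFun (P.map fun ω => partialSum X n (N n ω) ω / √(meanSumVar P X N n)) t -
        ∫ ω, mixtureKernel α t (sumVar P X n (N n ω) / meanSumVar P X N n) ∂P‖ ≤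
      4 * (1 + t ^ 2 * M) ^ 2 *
        (∫ ω, lindebergFraction P X ε n (N n ω) ∂P + ε + ε ^ 2) + 2 / M + |t| * |b - α| := by
  set D := meanSumVar P X N n with hDdef
  set U : Ω → ℝ := fun ω => sumVar P X n (N n ω) / D with hU
  have hU0 : ∀ ω, 0 ≤ U ω := fun ω => div_nonneg (sumVar_nonneg _ _) hD.le
  have hUint : Integrable U P := hBint.div_const D
  have hU1 : ∫ ω, U ω ∂P = 1 := by
    rw [integral_div]
    exact div_self hD.ne'
  have hfun : ∀ {E : Type} [MeasurableSpace E] (g : ℕ → E), Measurable fun ω => g (N n ω) :=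
    fun g => measurable_from_top.comp (hN n)
  have hLint : Integrable (fun ω => lindebergFraction P X ε n (N n ω)) P :=
    Integrable.of_bound (C := 1) (hfun _).aestronglyMeasurable (ae_of_all _ fun ω => by
      rw [Real.norm_eq_abs, abs_of_nonneg (lindebergFraction_nonneg _ _ _)]
      exact lindebergFraction_le_one hX hX2 _ _ _)
  have hSk := fun k => measurable_partialSum hX n k
  have hS : Measurable fun ω => partialSum X n (N n ω) ω / √D :=
    (measurable_randomIndex (hN n) hSk).div_const _
  have hcf : charFun (P.map fun ω => partialSum X n (N n ω) ω / √D) t =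
      ∫ ω, charFun (P.map (partialSum X n (N n ω))) (t / √D) ∂P := by
    have h := integral_randomIndex (hN n) hSk (hNind n)
      (f := fun x => Complex.exp (((t / √D : ℝ) : ℂ) * x * Complex.I)) (by fun_prop) fun x => by
        rw [← Complex.ofReal_mul, Complex.norm_exp_ofReal_mul_I]
    rw [charFun_apply_real, integral_map hS.aemeasurable (by fun_prop)]
    refine Eq.trans (integral_congr_ae (ae_of_all _ fun ω => ?_))
      (h.trans (integral_congr_ae (ae_of_all _ fun ω => ?_)))
    · push_cast
      ring_nf
    · simp only
      rw [charFun_apply_real, integral_map (hSk _).aemeasurable (by fun_prop)]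
  have hprob : ∀ k, IsProbabilityMeasure (P.map (partialSum X n k)) := fun k =>
    Measure.isProbabilityMeasure_map (hSk k).aemeasurable
  have hi1 : Integrable (fun ω => charFun (P.map (partialSum X n (N n ω))) (t / √D)) P :=
    Integrable.of_bound (C := 1)
      (hfun fun k => charFun (P.map (partialSum X n k)) (t / √D)).aestronglyMeasurable
      (ae_of_all _ fun ω => norm_charFun_le_one _)
  have hKle : ∀ ω, ‖mixtureKernel α t (U ω)‖ ≤ 1 := fun ω =>
    norm_cexp_drift_le_one α t (le_max_right _ _)
  have hi2 : Integrable (fun ω => mixtureKernel α t (U ω)) P :=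
    Integrable.of_bound (C := 1)
      ((mixtureKernel α t).continuous.measurable.comp
        (hfun fun k => sumVar P X n k / D)).aestronglyMeasurable (ae_of_all _ hKle)
  rw [hcf, ← integral_sub hi1 hi2]
  set C := 4 * (1 + t ^ 2 * M) ^ 2 with hC
  have hC0 : 0 ≤ C := by positivity
  have hb1 : Integrable (fun ω => C * (lindebergFraction P X ε n (N n ω) + (ε + ε ^ 2))) P :=
    (hLint.add (integrable_const _)).const_mul C
  have hb2 : Integrable (fun ω => (2 / M + |t| * |b - α|) * U ω) P := hUint.const_mul _
  have hbound : ∫ ω, (C * (lindebergFraction P X ε n (N n ω) + (ε + ε ^ 2)) +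
      (2 / M + |t| * |b - α|) * U ω) ∂P =
      C * (∫ ω, lindebergFraction P X ε n (N n ω) ∂P + ε + ε ^ 2) + 2 / M + |t| * |b - α| := by
    rw [integral_add hb1 hb2, integral_const_mul, integral_const_mul, hU1,
      integral_add hLint (integrable_const _)]
    simp
    ring
  rw [← hbound]
  refine norm_integral_le_of_norm_le (hb1.add hb2) (ae_of_all _ fun ω => ?_)
  have hL0 : 0 ≤ lindebergFraction P X ε n (N n ω) := lindebergFraction_nonneg _ _ _
  have hUω := hU0 ω
  rcases le_or_gt (U ω) M with h | h
  · have h1 := norm_charFun_partialSum_sub_le hX hX2 hpos hind hD hmean (N n ω) t hε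
    have h2 := norm_cexp_drift_sub_le b α t hUω
    have h3 := norm_sub_le_norm_sub_add_norm_sub
      (charFun (P.map (partialSum X n (N n ω))) (t / √D))
      (Complex.exp ((t * b * Complex.I - t ^ 2 / 2) * (U ω : ℂ))) (mixtureKernel α t (U ω))
    have h4 : 4 * (1 + t ^ 2 * U ω) ^ 2 * (lindebergFraction P X ε n (N n ω) + ε + ε ^ 2) ≤
        C * (lindebergFraction P X ε n (N n ω) + (ε + ε ^ 2)) := by
      rw [hC, add_assoc]
      gcongr
    have h5 : 0 ≤ 2 / M * U ω := by positivity
    rw [mixtureKernel_apply, max_eq_left hUω] at h3 ⊢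
    linarith
  · have h1 : ‖charFun (P.map (partialSum X n (N n ω))) (t / √D) - mixtureKernel α t (U ω)‖ ≤ 2 :=
      (norm_sub_le _ _).trans
        ((add_le_add (norm_charFun_le_one _) (hKle ω)).trans (by norm_num))
    have h2 : 2 ≤ 2 / M * U ω := by
      rw [div_mul_eq_mul_div, le_div_iff₀ hM]
      linarith
    have h3 : 0 ≤ C * (lindebergFraction P X ε n (N n ω) + (ε + ε ^ 2)) := by positivity
    have h4 : 0 ≤ |t| * |b - α| * U ω := by positivity
    linarith

/-- Under the random Lindeberg condition the normalized random sum and the normal mixture over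
the law of `B_{n,N_n}² / D_n` have asymptotically equal characteristic functions. -/
lemma tendsto_charFun_randomSum_sub (hX : ∀ n j, Measurable (X n j))
    (hX2 : ∀ n j, MemLp (X n j) 2 P) (hpos : ∀ n j, 0 < Var[X n j; P])
    (hind : ∀ n, iIndepFun (X n) P) (hN : ∀ n, Measurable (N n))
    (hNind : ∀ n k, IndepFun (N n) (partialSum X n k) P)
    (hBint : ∀ n, Integrable (fun ω => sumVar P X n (N n ω)) P)
    (hD : ∀ n, 0 < meanSumVar P X N n) {a : ℕ → ℝ} {α : ℝ}
    (hmean : ∀ n j, ∫ ω, X n j ω ∂P = a n * Var[X n j; P] / √(meanSumVar P X N n))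
    (ha : Tendsto a atTop (𝓝 α)) (hlind : RandomLindeberg P X N) (t : ℝ) :
    Tendsto (fun n =>
      charFun (P.map fun ω => partialSum X n (N n ω) ω / √(meanSumVar P X N n)) t -
        ∫ ω, mixtureKernel α t (sumVar P X n (N n ω) / meanSumVar P X N n) ∂P) atTop (𝓝 0) := by
  rw [tendsto_zero_iff_norm_tendsto_zero]
  refine (tendsto_order.2 ⟨fun c hc => Eventually.of_forall fun n =>
    hc.trans_le (norm_nonneg _), fun c hc => ?_⟩)
  -- With the cut-off `M = 6 / c` the discarded event costs `c / 3`.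
  have hM : 0 < 6 / c := by positivity
  set C := 4 * (1 + t ^ 2 * (6 / c)) ^ 2 with hC
  have hε : ∃ ε : ℝ, 0 < ε ∧ C * (0 + ε + ε ^ 2) < c / 3 := by
    have h : Tendsto (fun ε : ℝ => C * (0 + ε + ε ^ 2)) (𝓝[>] 0) (𝓝 0) := by
      have : Continuous fun ε : ℝ => C * (0 + ε + ε ^ 2) := by fun_prop
      have h2 := this.tendsto 0
      simp only [add_zero, ne_eq, OfNat.ofNat_ne_zero, not_false_eq_true, zero_pow,
        mul_zero] at h2
      exact h2.mono_left nhdsWithin_le_nhds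
    obtain ⟨ε, h1, h2⟩ := ((h.eventually_lt_const (by positivity : (0 : ℝ) < c / 3)).and
      self_mem_nhdsWithin).exists
    exact ⟨ε, h2, h1⟩
  obtain ⟨ε, hε0, hεc⟩ := hε
  have hL : Tendsto (fun n => C * (∫ ω, lindebergFraction P X ε n (N n ω) ∂P + ε + ε ^ 2)) atTop
      (𝓝 (C * (0 + ε + ε ^ 2))) := (((hlind ε hε0).add_const ε).add_const (ε ^ 2)).const_mul C
  have hA : Tendsto (fun n => |t| * |a n - α|) atTop (𝓝 0) := by
    have := ((ha.sub_const α).abs).const_mul |t|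
    simpa using this
  filter_upwards [hL.eventually_lt_const hεc,
    hA.eventually_lt_const (by positivity : (0 : ℝ) < c / 3)] with n h1 h2
  have h3 := norm_charFun_randomSum_sub_le hX hX2 hpos hind hN hNind n (hBint n) (hD n) (hmean n)
    α t hε0.le hM
  have h4 : 2 / (6 / c) = c / 3 := by
    field_simp
    norm_num
  rw [h4] at h3
  linarith

end

/-! ### Convergence of mixtures and of mixing laws -/

lemma isTightMeasureSet_of_integral_le {Ω : Type*} [MeasurableSpace Ω] {P : Measure Ω}
    [IsProbabilityMeasure P] {U : ℕ → Ω → ℝ} (hm : ∀ n, Measurable (U n)) (h0 : ∀ n ω, 0 ≤ U n ω)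
    (hint : ∀ n, Integrable (U n) P) {c : ℝ} (hc : ∀ n, ∫ ω, U n ω ∂P ≤ c) :
    IsTightMeasureSet (Set.range fun n => P.map (U n)) := by
  refine isTightMeasureSet_of_tendsto_measure_norm_gt ?_
  have hlim : Tendsto (fun r : ℝ => ENNReal.ofReal (c / r)) atTop (𝓝 0) := by
    have := ENNReal.tendsto_ofReal (tendsto_const_nhds.div_atTop tendsto_id : Tendsto
      (fun r : ℝ => c / id r) atTop (𝓝 0))
    simpa using this
  refine tendsto_of_tendsto_of_tendsto_of_le_of_le' tendsto_const_nhds hlim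
    (Eventually.of_forall fun _ => zero_le) ?_
  filter_upwards [eventually_gt_atTop 0] with r hr
  refine iSup₂_le ?_
  rintro _ ⟨n, rfl⟩
  rw [Measure.map_apply (hm n) (measurableSet_lt measurable_const measurable_norm)]
  have hmk := mul_meas_ge_le_integral_of_nonneg (ae_of_all _ (h0 n)) (hint n) r
  rw [← ofReal_measureReal]
  refine ENNReal.ofReal_le_ofReal ?_
  rw [le_div_iff₀ hr, mul_comm]
  refine le_trans ?_ (hmk.trans (hc n))
  refine mul_le_mul_of_nonneg_left (measureReal_mono fun ω hω => ?_) hr.le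
  have h : r < ‖U n ω‖ := hω
  rw [Real.norm_eq_abs, abs_of_nonneg (h0 n ω)] at h
  exact h.le

/-- A weak limit point of laws on `[0, ∞)` lives on `[0, ∞)`. -/
lemma measure_Iio_zero_of_mapClusterPt {V : ℕ → ProbabilityMeasure ℝ} {ν : ProbabilityMeasure ℝ}
    (hV : ∀ n, (V n : Measure ℝ) (Set.Iio 0) = 0) (h : MapClusterPt ν atTop V) :
    (ν : Measure ℝ) (Set.Iio 0) = 0 := by
  obtain ⟨F, hF, hlim⟩ := mapClusterPt_iff_ultrafilter.1 h
  have := ProbabilityMeasure.le_liminf_measure_open_of_tendsto hlim isOpen_Iio (G := Set.Iio 0)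
  simpa [hV] using this

/-- If the mixtures over a tight sequence of laws on `[0, ∞)` converge, then so do the mixing
laws: by identifiability there is only one candidate for a limit point. -/
lemma exists_tendsto_of_tendsto_charFun_normalMixture {α : ℝ} {V : ℕ → ProbabilityMeasure ℝ}
    (htight : IsTightMeasureSet {((μ : ProbabilityMeasure ℝ) : Measure ℝ) | μ ∈ Set.range V})
    (hV : ∀ n, (V n : Measure ℝ) (Set.Iio 0) = 0) {ζ : ProbabilityMeasure ℝ}
    (hlim : ∀ t, Tendsto (fun n => charFun (normalMixture α (V n) : Measure ℝ) t) atTop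
      (𝓝 (charFun (ζ : Measure ℝ) t))) :
    ∃ ν, normalMixture α ν = ζ ∧ Tendsto V atTop (𝓝 ν) := by
  have hcomp : IsCompact (closure (Set.range V)) := isCompact_closure_of_isTightMeasureSet htight
  have hmem : ∀ᶠ n in atTop, V n ∈ closure (Set.range V) :=
    Eventually.of_forall fun n => subset_closure ⟨n, rfl⟩
  have hclus : ∀ ν, MapClusterPt ν atTop V → normalMixture α ν = ζ := by
    intro ν hν
    obtain ⟨F, hF, hνF⟩ := mapClusterPt_iff_ultrafilter.1 hν
    refine Subtype.ext (show (normalMixture α ν : Measure ℝ) = ζ from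
      Measure.ext_of_charFun (funext fun t => ?_))
    exact tendsto_nhds_unique (((continuous_charFun_normalMixture α t).tendsto ν).comp hνF)
      ((hlim t).mono_left hF)
  obtain ⟨ν, -, hν⟩ := hcomp.exists_mapClusterPt (f := atTop) (u := V)
    (le_principal_iff.2 hmem)
  refine ⟨ν, hclus ν hν, hcomp.tendsto_nhds_of_unique_mapClusterPt hmem fun ν' _ hν' => ?_⟩
  exact normalMixture_injOn α (measure_Iio_zero_of_mapClusterPt hV hν')
    (measure_Iio_zero_of_mapClusterPt hV hν)
    ((hclus ν' hν').trans (hclus ν hν).symm)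

lemma convergesToLaw_iff {Ω : Type*} [MeasurableSpace Ω] {P : Measure Ω} [IsProbabilityMeasure P]
    {Y : ℕ → Ω → ℝ} (hY : ∀ n, Measurable (Y n)) {ν : ProbabilityMeasure ℝ} :
    ConvergesToLaw P Y ν ↔ Tendsto (β := ProbabilityMeasure ℝ)
      (fun n => ⟨P.map (Y n), Measure.isProbabilityMeasure_map (hY n).aemeasurable⟩) atTop
      (𝓝 ν) := by
  have e : (⟨(ν : Measure ℝ).map id, Measure.isProbabilityMeasure_map aemeasurable_id⟩ :
      ProbabilityMeasure ℝ) = ν := Subtype.ext Measure.map_id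
  constructor
  · intro h
    have h2 := h.tendsto
    rwa [e] at h2
  · intro h
    refine ⟨fun n => (hY n).aemeasurable, aemeasurable_id, ?_⟩
    rwa [e]

end RandomSums

end

theorem theorem4 {Ω : Type*} [MeasurableSpace Ω] (P : Measure Ω) [IsProbabilityMeasure P]
    (X : ℕ → ℕ → Ω → ℝ) (N : ℕ → Ω → ℕ) (a : ℕ → ℝ) (α : ℝ)
    -- the summands: random variables with finite positive variances, independent in each row
    (hX_meas : ∀ n j, Measurable (X n j))
    (hX_sq : ∀ n j, MemLp (X n j) 2 P)
    (hX_var : ∀ n j, 0 < Var[X n j; P])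
    (hX_indep : ∀ n, iIndepFun (X n) P)
    -- the indices: independent of each partial sum of the same row
    (hN_meas : ∀ n, Measurable (N n))
    (hN_indep : ∀ n k, IndepFun (N n) (RandomSums.partialSum X n k) P)
    -- the normalizing constants are finite and positive
    (hB_int : ∀ n, Integrable (fun ω => RandomSums.sumVar P X n (N n ω)) P)
    (hB_pos : ∀ n, 0 < RandomSums.meanSumVar P X N n)
    -- condition (i)
    (h_mean : ∀ n j, ∫ ω, X n j ω ∂P =
      a n * Var[X n j; P] / √(RandomSums.meanSumVar P X N n))
    (ha : Tendsto a atTop (𝓝 α)) (hα : α ≠ 0)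
    -- condition (ii)
    (h_lindeberg : RandomSums.RandomLindeberg P X N) :
    -- convergence to a given `Z` (with law `ζ`)
    (∀ ζ : ProbabilityMeasure ℝ,
      RandomSums.ConvergesToLaw P
          (fun n ω => RandomSums.partialSum X n (N n ω) ω / √(RandomSums.meanSumVar P X N n)) ζ ↔
        ∃ ν : ProbabilityMeasure ℝ,
          RandomSums.IsNormalVarianceMeanMixture α ζ ν ∧
          RandomSums.ConvergesToLaw P
            (fun n ω => RandomSums.sumVar P X n (N n ω) / RandomSums.meanSumVar P X N n) ν) ∧
    -- existence of a limit
    ((∃ ζ : ProbabilityMeasure ℝ,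
      RandomSums.ConvergesToLaw P
          (fun n ω => RandomSums.partialSum X n (N n ω) ω / √(RandomSums.meanSumVar P X N n)) ζ) ↔
        ∃ ν : ProbabilityMeasure ℝ,
          RandomSums.ConvergesToLaw P
            (fun n ω => RandomSums.sumVar P X n (N n ω) / RandomSums.meanSumVar P X N n) ν) := by
  have hS : ∀ n, Measurable fun ω =>
      RandomSums.partialSum X n (N n ω) ω / √(RandomSums.meanSumVar P X N n) := fun n =>
    (RandomSums.measurable_randomIndex (hN_meas n)
      (RandomSums.measurable_partialSum hX_meas n)).div_const _
  have hU : ∀ n, Measurable fun ω =>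
      RandomSums.sumVar P X n (N n ω) / RandomSums.meanSumVar P X N n := fun n =>
    (measurable_from_top (f := fun k => RandomSums.sumVar P X n k /
      RandomSums.meanSumVar P X N n)).comp (hN_meas n)
  have hU0 : ∀ n ω, 0 ≤ RandomSums.sumVar P X n (N n ω) / RandomSums.meanSumVar P X N n :=
    fun n ω => div_nonneg (RandomSums.sumVar_nonneg _ _) (hB_pos n).le
  set V : ℕ → ProbabilityMeasure ℝ := fun n => ⟨P.map fun ω =>
    RandomSums.sumVar P X n (N n ω) / RandomSums.meanSumVar P X N n,
    Measure.isProbabilityMeasure_map (hU n).aemeasurable⟩ with hVdef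
  set W : ℕ → ProbabilityMeasure ℝ := fun n => ⟨P.map fun ω =>
    RandomSums.partialSum X n (N n ω) ω / √(RandomSums.meanSumVar P X N n),
    Measure.isProbabilityMeasure_map (hS n).aemeasurable⟩ with hWdef
  have hdiff : ∀ t, Tendsto (fun n => charFun (W n : Measure ℝ) t -
      charFun (RandomSums.normalMixture α (V n) : Measure ℝ) t) atTop (𝓝 0) := by
    intro t
    have h := RandomSums.tendsto_charFun_randomSum_sub hX_meas hX_sq hX_var hX_indep hN_meas
      hN_indep hB_int hB_pos h_mean ha h_lindeberg t
    refine h.congr fun n => ?_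
    rw [RandomSums.charFun_normalMixture]
    simp only [hVdef, hWdef, ProbabilityMeasure.coe_mk]
    rw [integral_map (hU n).aemeasurable
      (RandomSums.mixtureKernel α t).continuous.aestronglyMeasurable]
  have hV0 : ∀ n, (V n : Measure ℝ) (Set.Iio 0) = 0 := fun n => by
    simp only [hVdef, ProbabilityMeasure.coe_mk]
    rw [Measure.map_apply (hU n) measurableSet_Iio]
    convert measure_empty (μ := P)
    ext ω
    simpa using hU0 n ω
  have htight : IsTightMeasureSet
      {((μ : ProbabilityMeasure ℝ) : Measure ℝ) | μ ∈ Set.range V} := by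
    have h := RandomSums.isTightMeasureSet_of_integral_le hU hU0
      (fun n => (hB_int n).div_const _) (c := 1) fun n => by
        rw [integral_div]
        exact (div_self (hB_pos n).ne').le
    refine h.subset ?_
    rintro _ ⟨_, ⟨n, rfl⟩, rfl⟩
    exact ⟨n, rfl⟩
  simp only [RandomSums.convergesToLaw_iff hS, RandomSums.convergesToLaw_iff hU,
    RandomSums.isNormalVarianceMeanMixture_iff]
  have hforward : ∀ ζ, Tendsto W atTop (𝓝 ζ) →
      ∃ ν, RandomSums.normalMixture α ν = ζ ∧ Tendsto V atTop (𝓝 ν) := by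
    intro ζ hζ
    refine RandomSums.exists_tendsto_of_tendsto_charFun_normalMixture htight hV0 fun t => ?_
    have h := (ProbabilityMeasure.tendsto_iff_tendsto_charFun.1 hζ t).sub (hdiff t)
    simpa using h
  have hbackward : ∀ ν, Tendsto V atTop (𝓝 ν) →
      Tendsto W atTop (𝓝 (RandomSums.normalMixture α ν)) := by
    intro ν hν
    refine ProbabilityMeasure.tendsto_iff_tendsto_charFun.2 fun t => ?_
    have h := (hdiff t).add
      (((RandomSums.continuous_charFun_normalMixture α t).tendsto ν).comp hν)
    simpa using h
  refine ⟨fun ζ => ⟨hforward ζ, ?_⟩, ⟨?_, ?_⟩⟩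
  · rintro ⟨ν, rfl, hν⟩
    exact hbackward ν hν
  · rintro ⟨ζ, hζ⟩
    obtain ⟨ν, -, hν⟩ := hforward ζ hζ
    exact ⟨ν, hν⟩
  · rintro ⟨ν, hν⟩
    exact ⟨_, hbackward ν hν⟩
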